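/- Let $\mathbb K$ be a field of characteristic zero. For $r,s\in\mathbb K^{*}$ and $\phi\in\mathbb K[t]$ let $\mathcal A(r,s,\phi)$ be the (unital associative) $\mathbb K$-algebra generated by $u,d,t$ subject to $$tu=ut,\quad td=dt,\quad d^{2}u=(r+s)\,dud-rs\,ud^{2}+\phi(t)\,d,\quad du^{2}=(r+s)\,udu-rs\,u^{2}d+u\,\phi(t).$$ Call a pair $r,s\in\mathbb K^{*}$ multiplicatively independent if, for $i,j\in\mathbb Z$, $r^{i}s^{j}=1$ implies $i=j=0$. For $\phi_1,\phi_2\in\mathbb K[t]$ write $\phi_1\sim\phi_2$ if there are $a,\eta\in\mathbb K^{*}$ and $b\in\mathbb K$ such that $\phi_1(at+b)=\eta\,\phi_2(t)$. Isomorphisms are isomorphisms of $\mathbb K$-algebras. Assume throughout that all the parameters $r,s,r_1,s_1,r_2,s_2\in\mathbb K^{*}$ are not roots of unity, and let $\phi_1,\phi_2\in\mathbb K[t]$ be arbitrary. 1. If $r_1,s_1$ are multiplicatively independent and $r_2,s_2$ are not, then $\mathcal A(r_1,s_1,\phi_1)\not\cong\mathcal A(r_2,s_2,\phi_2)$. 2.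 If $r,s$ are multiplicatively independent, then $\mathcal A(r,s,\phi_1)\cong\mathcal A(r,s,\phi_2)$ if and only if $\phi_1\sim\phi_2$. 3. If $r_1,s_1$ are multiplicatively independent and $r_2,s_2$ are multiplicatively independent, then $\mathcal A(r_1,s_1,\phi_1)\cong\mathcal A(r_2,s_2,\phi_2)$ if and only if one of the following holds: (a) $r_1=r_2$, $s_1=s_2$ and $\phi_1\sim\phi_2$; (b) $r_1=s_2$, $r_2=s_1$ and $\phi_1\sim\phi_2$; (c) $r_1=s_2^{-1}$, $r_2=s_1^{-1}$ and $\phi_1\sim\phi_2$; (d) $r_1=r_2^{-1}$, $s_1=s_2^{-1}$ and $\phi_1\sim\phi_2$. 4. $\mathcal A(r,r^{-1},\phi_1)\cong\mathcal A(r,r^{-1},\phi_2)$ if and only if $\phi_1\sim\phi_2$. -/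

import Mathlib

open Polynomial

namespace DownUp

/-- The three generators `u`, `d`, `t`. -/
inductive Gen : Type
  | u
  | d
  | t

/-- The generator `u` in the free algebra `K⟨u, d, t⟩`. -/
def U (K : Type*) [Field K] : FreeAlgebra K Gen := FreeAlgebra.ι K Gen.u

/-- The generator `d` in the free algebra `K⟨u, d, t⟩`. -/
def D (K : Type*) [Field K] : FreeAlgebra K Gen := FreeAlgebra.ι K Gen.d

/-- The generator `t` in the free algebra `K⟨u, d, t⟩`. -/
def T (K : Type*) [Field K] : FreeAlgebra K Gen := FreeAlgebra.ι K Gen.t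

/-- The defining relations of the down-up algebra with parameters `α`, `β ∈ K`, `φ ∈ K[t]`. -/
inductive Rel {K : Type*} [Field K] (α β : K) (φ : K[X]) :
    FreeAlgebra K Gen → FreeAlgebra K Gen → Prop
  | tu : Rel α β φ (T K * U K) (U K * T K)
  | td : Rel α β φ (T K * D K) (D K * T K)
  | ddu : Rel α β φ (D K ^ 2 * U K)
      (α • (D K * U K * D K) + β • (U K * D K ^ 2) + aeval (T K) φ * D K)
  | duu : Rel α β φ (D K * U K ^ 2)
      (α • (U K * D K * U K) + β • (U K ^ 2 * D K) + U K * aeval (T K) φ)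

/-- The down-up algebra over the base ring `K[t]` with parameters `α`, `β`, `φ`: the `K`-algebra
generated by `u`, `d`, `t` subject to the relations `Rel α β φ`. -/
abbrev Alg {K : Type*} [Field K] (α β : K) (φ : K[X]) : Type _ := RingQuot (Rel α β φ)

/-- `A(r, s, φ)`: the down-up algebra whose parameters are `α = r + s` and `β = -rs`. -/
abbrev A {K : Type*} [Field K] (r s : K) (φ : K[X]) : Type _ := Alg (r + s) (-(r * s)) φ

/-- Multiplicative independence of two (nonzero) scalars: `r ^ i * s ^ j = 1` with integers
`i`, `j` only for `i = j = 0`. -/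
def MulIndep {K : Type*} [Field K] (r s : K) : Prop :=
  ∀ i j : ℤ, r ^ i * s ^ j = 1 → i = 0 ∧ j = 0

/-- `φ₁(a t + b) = η φ₂(t)` for some nonzero `a`, `η` and some `b` in `K`. -/
def AffEquiv {K : Type*} [Field K] (φ₁ φ₂ : K[X]) : Prop :=
  ∃ a b η : K, a ≠ 0 ∧ η ≠ 0 ∧ φ₁.comp (C a * X + C b) = C η * φ₂

end DownUp

/-!
Representations of dimension one recover `φ` up to `∼` as soon as `r, s ≠ 1`, and representations of
dimension two recover the unordered pair `{r, s}` up to simultaneous inversion when `r` and `s` are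
not roots of unity. Multiplicative independence only serves to distinguish `r ^ n` from `s ^ n`. The
isomorphisms in the converse directions are explicit: an affine change of `t` with a rescaling of
`u`, and the exchange of `u` and `d`, which inverts both parameters (`IsTriple.swap`).

*The polynomial.* With `c = (1 - r) (1 - s)`, the characters of `A r s φ` are the triples
`(u, d, t)` with `u (c u d - φ(t)) = d (c u d - φ(t)) = 0`: the line `u = d = 0` and the surface
`c u d = φ(t)`. If `φ ≠ 0`, the line is rigid, in the sense that its generic point has no tangent
vectors except those along the line, whereas a curve in the surface always has others; hence an
isomorphism preserves the line (`line_eq_zero`) and acts on it by `t ↦ a t + b`. The points of the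
line that have further tangent vectors form the subscheme `φ = 0`, which is therefore preserved too
(`exists_dvd_comp`), and `φ₁ ∼ φ₂` follows (`affEquiv_of_algEquiv`). Tangent vectors are
homomorphisms into dual numbers.

*The parameters.* Over the fibre `t = 0` there is the character `u ↦ v`, `d ↦ k v⁻¹` with values in
`K[v, v⁻¹]`, and it has a non-commutative extension by its translate under `v ↦ l v` when
`l ∈ {r, s}` (`triangular`). Conversely, in a non-commutative triangular representation of a
down-up algebra, one of the elements `d u - r u d + k` and `d u - u d` is a nonzero strictly
triangular matrix that skew-commutes with `u` and `d`, so that the two diagonal characters are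
related by scaling with `r` or `s` (`exists_diag_ratio`). Pulling `triangular` back along an
isomorphism `A r₁ s₁ φ₁ ≃ A r₂ s₂ φ₂` shows that the images of `u` and `d` in `K[v, v⁻¹]` are
multiples of `v ^ n` and `v ^ (-n)`, where `l ^ n ∈ {r₁, s₁}` for `l ∈ {r₂, s₂}`; as these images
generate an algebra containing `v`, the exponent is `n = ± 1` (`exists_zpow_eq`).
-/

namespace DownUp

/-! ### The universal property -/

/-- A triple `u`, `d`, `t` in a `K`-algebra satisfying the defining relations of `Alg α β φ`. -/
structure IsTriple {K B : Type*} [Field K] [Ring B] [Algebra K B] (α β : K) (φ : K[X])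
    (u d t : B) : Prop where
  tu : t * u = u * t
  td : t * d = d * t
  ddu : d ^ 2 * u = α • (d * u * d) + β • (u * d ^ 2) + aeval t φ * d
  duu : d * u ^ 2 = α • (u * d * u) + β • (u ^ 2 * d) + u * aeval t φ

section API

variable {K : Type*} [Field K] (α β : K) (φ : K[X])

/-- The image of the generator `u` in the down-up algebra. -/
noncomputable def gu : Alg α β φ := RingQuot.mkAlgHom K (Rel α β φ) (U K)

/-- The image of the generator `d` in the down-up algebra. -/
noncomputable def gd : Alg α β φ := RingQuot.mkAlgHom K (Rel α β φ) (D K)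

/-- The image of the generator `t` in the down-up algebra. -/
noncomputable def gt : Alg α β φ := RingQuot.mkAlgHom K (Rel α β φ) (T K)

lemma isTriple_gen : IsTriple α β φ (gu α β φ) (gd α β φ) (gt α β φ) := by
  constructor
  · simpa [gu, gt] using RingQuot.mkAlgHom_rel K (Rel.tu (α := α) (β := β) (φ := φ))
  · simpa [gd, gt] using RingQuot.mkAlgHom_rel K (Rel.td (α := α) (β := β) (φ := φ))
  · simpa [gu, gd, gt, ← aeval_algHom_apply] using
      RingQuot.mkAlgHom_rel K (Rel.ddu (α := α) (β := β) (φ := φ))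
  · simpa [gu, gd, gt, ← aeval_algHom_apply] using
      RingQuot.mkAlgHom_rel K (Rel.duu (α := α) (β := β) (φ := φ))

variable {α β φ} {B : Type*} [Ring B] [Algebra K B]

lemma IsTriple.map {B' : Type*} [Ring B'] [Algebra K B'] {u d t : B} (h : IsTriple α β φ u d t)
    (f : B →ₐ[K] B') : IsTriple α β φ (f u) (f d) (f t) := by
  constructor
  · rw [← map_mul, h.tu, map_mul]
  · rw [← map_mul, h.td, map_mul]
  · simpa [← aeval_algHom_apply] using congrArg f h.ddu
  · simpa [← aeval_algHom_apply] using congrArg f h.duu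

/-- The algebra homomorphism out of the down-up algebra defined by a triple satisfying the
relations. -/
noncomputable def lift {u d t : B} (h : IsTriple α β φ u d t) : Alg α β φ →ₐ[K] B :=
  RingQuot.liftAlgHom K ⟨FreeAlgebra.lift K (fun g => Gen.casesOn g u d t), by
    intro x y hxy
    have hu : FreeAlgebra.lift K (fun g => Gen.casesOn g u d t) (U K) = u := by simp [U]
    have hd : FreeAlgebra.lift K (fun g => Gen.casesOn g u d t) (D K) = d := by simp [D]
    have ht : FreeAlgebra.lift K (fun g => Gen.casesOn g u d t) (T K) = t := by simp [T]
    cases hxy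
    · rw [map_mul, map_mul, hu, ht, h.tu]
    · rw [map_mul, map_mul, hd, ht, h.td]
    · simp only [map_mul, map_add, map_smul, map_pow, ← aeval_algHom_apply, hu, hd, ht, h.ddu]
    · simp only [map_mul, map_add, map_smul, map_pow, ← aeval_algHom_apply, hu, hd, ht, h.duu]⟩

variable {u d t : B} (h : IsTriple α β φ u d t)

@[simp] lemma lift_gu : lift h (gu α β φ) = u := by simp [lift, gu, U]

@[simp] lemma lift_gd : lift h (gd α β φ) = d := by simp [lift, gd, D]

@[simp] lemma lift_gt : lift h (gt α β φ) = t := by simp [lift, gt, T]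

lemma hom_ext {f g : Alg α β φ →ₐ[K] B} (hu : f (gu α β φ) = g (gu α β φ))
    (hd : f (gd α β φ) = g (gd α β φ)) (ht : f (gt α β φ) = g (gt α β φ)) : f = g := by
  apply RingQuot.ringQuot_ext'
  ext x
  cases x
  · exact hu
  · exact hd
  · exact ht

/-- The generators generate: a property stable under the algebra operations and true of the
generators holds everywhere. -/
lemma gen_induction {p : Alg α β φ → Prop} (hu : p (gu α β φ)) (hd : p (gd α β φ))
    (ht : p (gt α β φ)) (hC : ∀ k : K, p (algebraMap K _ k))
    (hadd : ∀ x y, p x → p y → p (x + y)) (hmul : ∀ x y, p x → p y → p (x * y))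
    (x : Alg α β φ) : p x := by
  obtain ⟨a, rfl⟩ := RingQuot.mkAlgHom_surjective K (Rel α β φ) x
  induction a using FreeAlgebra.induction with
  | grade0 k => simpa using hC k
  | grade1 g =>
    cases g
    · exact hu
    · exact hd
    · exact ht
  | mul x y hx hy => simpa using hmul _ _ hx hy
  | add x y hx hy => simpa using hadd _ _ hx hy

lemma commute_gt (x : Alg α β φ) : Commute (gt α β φ) x := by
  have h := isTriple_gen α β φ
  induction x using gen_induction with
  | hu => exact h.tu
  | hd => exact h.td
  | ht => exact Commute.refl _
  | hC k => exact Algebra.commute_algebraMap_right k _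
  | hadd x y hx hy => exact hx.add_right hy
  | hmul x y hx hy => exact hx.mul_right hy

end API

section Comm

variable {K B : Type*} [Field K] [CommRing B] [Algebra K B] {r s : K} {φ : K[X]} {u d t : B}

/-- In a commutative algebra the defining relations say that both `u` and `d` are annihilated by
`(1 - r) (1 - s) u d - φ(t)`. -/
lemma isTriple_comm_iff : IsTriple (r + s) (-(r * s)) φ u d t ↔
    u * (((1 - r) * (1 - s)) • (u * d) - aeval t φ) = 0 ∧
    d * (((1 - r) * (1 - s)) • (u * d) - aeval t φ) = 0 := by
  constructor
  · intro h
    have h1 := h.ddu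
    have h2 := h.duu
    simp only [Algebra.smul_def, map_mul, map_add, map_neg, map_sub, map_one] at h1 h2 ⊢
    exact ⟨by linear_combination h2, by linear_combination h1⟩
  · rintro ⟨h2, h1⟩
    refine ⟨mul_comm _ _, mul_comm _ _, ?_, ?_⟩
    all_goals simp only [Algebra.smul_def, map_mul, map_add, map_neg, map_sub, map_one] at h1 h2 ⊢
    · linear_combination h1
    · linear_combination h2

end Comm

/-! ### Isomorphisms between down-up algebras -/

section Isos

variable {K : Type*} [Field K]

/-- Two triples that are expressed through each other define inverse isomorphisms. -/
lemma nonempty_algEquiv {α β α' β' : K} {φ φ' : K[X]} {u d t : Alg α' β' φ'}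
    {u' d' t' : Alg α β φ} (h : IsTriple α β φ u d t) (h' : IsTriple α' β' φ' u' d' t')
    (hu : lift h' u = gu α β φ) (hd : lift h' d = gd α β φ) (ht : lift h' t = gt α β φ)
    (hu' : lift h u' = gu α' β' φ') (hd' : lift h d' = gd α' β' φ')
    (ht' : lift h t' = gt α' β' φ') : Nonempty (Alg α β φ ≃ₐ[K] Alg α' β' φ') :=
  ⟨AlgEquiv.ofAlgHom (lift h) (lift h') (hom_ext (by simpa) (by simpa) (by simpa))
    (hom_ext (by simpa) (by simpa) (by simpa))⟩

lemma IsTriple.affine {B : Type*} [Ring B] [Algebra K B] {α β : K} {φ φ' : K[X]} {u d t : B}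
    (h : IsTriple α β φ u d t) (a b η : K)
    (e : aeval (a • t + algebraMap K B b) φ' = η • aeval t φ) :
    IsTriple α β φ' (η • u) d (a • t + algebraMap K B b) := by
  constructor
  · simp only [add_mul, mul_add, smul_mul_assoc, mul_smul_comm, h.tu, Algebra.commutes, smul_add]
    rw [smul_comm]
  · simp only [add_mul, mul_add, smul_mul_assoc, mul_smul_comm, h.td, Algebra.commutes]
  · rw [e]
    simp only [smul_mul_assoc, mul_smul_comm, h.ddu, smul_add, smul_comm η]
  · rw [e, _root_.smul_pow]
    simp only [smul_mul_assoc, mul_smul_comm, h.duu, smul_add, smul_smul]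
    ring_nf

lemma nonempty_algEquiv_of_affEquiv (α β : K) {φ₁ φ₂ : K[X]} (h : AffEquiv φ₁ φ₂) :
    Nonempty (Alg α β φ₁ ≃ₐ[K] Alg α β φ₂) := by
  obtain ⟨a, b, η, ha, hη, h⟩ := h
  have e1 : ∀ {α β : K} {φ : K[X]} (t : Alg α β φ),
      aeval (a • t + algebraMap K _ b) φ₁ = η • aeval t φ₂ := by
    intro α β φ t
    simpa [aeval_comp, Algebra.smul_def] using congrArg (aeval t) h
  have e2 : ∀ {α β : K} {φ : K[X]} (t : Alg α β φ),
      aeval (a⁻¹ • t + algebraMap K _ (-(a⁻¹ * b))) φ₂ = η⁻¹ • aeval t φ₁ := by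
    intro α β φ t
    have := e1 (a⁻¹ • t + algebraMap K _ (-(a⁻¹ * b)))
    rw [eq_inv_smul_iff₀ hη, ← this]
    simp [Algebra.algebraMap_eq_smul_one, smul_add, smul_smul, ha, -map_inv₀]
  refine nonempty_algEquiv ((isTriple_gen α β φ₂).affine a b η (e1 _))
    ((isTriple_gen α β φ₁).affine a⁻¹ (-(a⁻¹ * b)) η⁻¹ (e2 _))
    (u' := η⁻¹ • gu α β φ₁) (d' := gd α β φ₁)
    (u := η • gu α β φ₂) (d := gd α β φ₂) ?_ ?_ ?_ ?_ ?_ ?_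
  all_goals simp [Algebra.algebraMap_eq_smul_one, smul_add, smul_smul, ha, hη]
  module

lemma commute_aeval {B : Type*} [Ring B] [Algebra K B] {t x : B} (h : Commute t x) (φ : K[X]) :
    Commute (aeval t φ) x := by
  induction φ using Polynomial.induction_on' with
  | add p q hp hq => simpa using hp.add_left hq
  | monomial n a =>
    simpa [aeval_monomial] using (Algebra.commute_algebraMap_left a x).mul_left (h.pow_left n)

/-- The defining relations are symmetric under exchanging `u` and `d`, up to inverting `r`, `s`
and rescaling `φ`. -/
lemma IsTriple.swap {B : Type*} [Ring B] [Algebra K B] {r s : K} (hr : r ≠ 0) (hs : s ≠ 0)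
    {φ : K[X]} {u d t : B} (h : IsTriple (r + s) (-(r * s)) φ u d t) :
    IsTriple (r⁻¹ + s⁻¹) (-(r⁻¹ * s⁻¹)) (C (r⁻¹ * s⁻¹) * φ) d u t := by
  have e : aeval t (C (r⁻¹ * s⁻¹) * φ) = (r⁻¹ * s⁻¹) • aeval t φ := by simp [Algebra.smul_def]
  have hu : Commute (aeval t φ) u := commute_aeval h.tu φ
  have hd : Commute (aeval t φ) d := commute_aeval h.td φ
  refine ⟨h.td, h.tu, ?_, ?_⟩
  · rw [e, h.duu, smul_mul_assoc, hu.eq]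
    match_scalars <;> field_simp <;> ring
  · rw [e, h.ddu, mul_smul_comm, hd.eq]
    match_scalars <;> field_simp <;> ring

lemma nonempty_algEquiv_inv {r s : K} (hr : r ≠ 0) (hs : s ≠ 0) (φ : K[X]) :
    Nonempty (A r s φ ≃ₐ[K] A r⁻¹ s⁻¹ (C (r⁻¹ * s⁻¹) * φ)) := by
  have h := (isTriple_gen (r⁻¹ + s⁻¹) (-(r⁻¹ * s⁻¹)) (C (r⁻¹ * s⁻¹) * φ)).swap
    (inv_ne_zero hr) (inv_ne_zero hs)
  have e : C (r⁻¹⁻¹ * s⁻¹⁻¹) * (C (r⁻¹ * s⁻¹) * φ) = φ := by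
    rw [← mul_assoc, ← C_mul, inv_inv, inv_inv]
    field_simp
    simp
  rw [e, inv_inv, inv_inv] at h
  refine nonempty_algEquiv h ((isTriple_gen (r + s) (-(r * s)) φ).swap hr hs)
    (u' := gd _ _ φ) (d' := gu _ _ φ) (t' := gt _ _ φ)
    (u := gd _ _ _) (d := gu _ _ _) (t := gt _ _ _) ?_ ?_ ?_ ?_ ?_ ?_
  all_goals simp

end Isos

/-! ### The line of degenerate characters and the polynomial `φ` -/

section Line

open TrivSqZeroExt

variable {K : Type*} [Field K]

lemma snd_aeval_dual {R : Type*} [CommRing R] [Algebra K R] (x : DualNumber R) (φ : K[X]) :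
    (aeval x φ).snd = x.snd * aeval x.fst (derivative φ) := by
  have h : (inr x.snd : DualNumber R) ^ 2 = 0 := by rw [pow_two, inr_mul_inr]
  have e : ∀ ψ : K[X], aeval (inl x.fst : DualNumber R) ψ = inl (aeval x.fst ψ) := fun ψ =>
    aeval_algHom_apply (inlAlgHom K R R) x.fst ψ
  conv_lhs => rw [← inl_fst_add_inr_snd_eq x, aeval_add_of_sq_eq_zero _ _ _ h, e, e]
  simp [mul_comm]

lemma fst_aeval_dual {R : Type*} [CommRing R] [Algebra K R] (x : DualNumber R) (φ : K[X]) :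
    (aeval x φ).fst = aeval x.fst φ :=
  (aeval_algHom_apply (fstHom K R R) x φ).symm

/-- The defining relations over the dual numbers: the relations for the constant terms together
with their linearizations. -/
lemma isTriple_dual_iff {R : Type*} [CommRing R] [Algebra K R] {r s : K} {φ : K[X]}
    {u d t : DualNumber R} : IsTriple (r + s) (-(r * s)) φ u d t ↔
    (u.fst * (((1 - r) * (1 - s)) • (u.fst * d.fst) - aeval t.fst φ) = 0 ∧
      u.fst * (((1 - r) * (1 - s)) • (u.fst * d.snd + u.snd * d.fst)
        - t.snd * aeval t.fst (derivative φ))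
      + u.snd * (((1 - r) * (1 - s)) • (u.fst * d.fst) - aeval t.fst φ) = 0) ∧
    (d.fst * (((1 - r) * (1 - s)) • (u.fst * d.fst) - aeval t.fst φ) = 0 ∧
      d.fst * (((1 - r) * (1 - s)) • (u.fst * d.snd + u.snd * d.fst)
        - t.snd * aeval t.fst (derivative φ))
      + d.snd * (((1 - r) * (1 - s)) • (u.fst * d.fst) - aeval t.fst φ) = 0) := by
  simp only [isTriple_comm_iff, TrivSqZeroExt.ext_iff, fst_mul, DualNumber.snd_mul, fst_sub,
    snd_sub, fst_smul, snd_smul, fst_zero, snd_zero, snd_aeval_dual, fst_aeval_dual]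

lemma isTriple_zero {B : Type*} [Ring B] [Algebra K B] (α β : K) (φ : K[X]) (t : B) :
    IsTriple α β φ 0 0 t := by
  constructor <;> simp

/-- The generic point of the line of characters killing `u` and `d`: the quotient map onto
`K[t]`. -/
noncomputable def line (α β : K) (φ : K[X]) : Alg α β φ →ₐ[K] K[X] :=
  lift (isTriple_zero α β φ X)

@[simp] lemma line_gu (α β : K) (φ : K[X]) : line α β φ (gu α β φ) = 0 := lift_gu _

@[simp] lemma line_gd (α β : K) (φ : K[X]) : line α β φ (gd α β φ) = 0 := lift_gd _

@[simp] lemma line_gt (α β : K) (φ : K[X]) : line α β φ (gt α β φ) = X := lift_gt _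

variable {r₁ s₁ r₂ s₂ : K} {φ₁ φ₂ : K[X]}

/-- If `φ₂ ≠ 0`, the line of degenerate characters has no infinitesimal deformation except along
itself. An isomorphism transports this property. -/
lemma exists_snd_eq_mul_derivative (θ : A r₁ s₁ φ₁ ≃ₐ[K] A r₂ s₂ φ₂) (hφ : φ₂ ≠ 0)
    (f : A r₁ s₁ φ₁ →ₐ[K] DualNumber K[X]) (hf : ∀ a, (f a).fst = line _ _ _ (θ a)) :
    ∃ ρ : K[X], ∀ a, (f a).snd = ρ * derivative (line _ _ _ (θ a)) := by
  set g := f.comp (θ.symm : A r₂ s₂ φ₂ →ₐ[K] A r₁ s₁ φ₁) with hg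
  have hfst : ∀ x, (g x).fst = line _ _ _ x := fun x => by simp [hg, hf]
  have h := isTriple_dual_iff.1 ((isTriple_gen (r₂ + s₂) (-(r₂ * s₂)) φ₂).map g)
  simp only [hfst] at h
  simp [hφ] at h
  obtain ⟨hu, hd⟩ := h
  refine ⟨(g (gt _ _ _)).snd, fun a => ?_⟩
  have key : g = (aeval (g (gt _ _ _))).comp (line _ _ _) := by
    apply hom_ext
    · ext1 <;> simp [hfst, hu]
    · ext1 <;> simp [hfst, hd]
    · simp
  have := congrArg snd (DFunLike.congr_fun key (θ a))
  rw [AlgHom.comp_apply (aeval _), snd_aeval_dual, hfst] at this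
  simpa [hg] using this

/-- If `φ₂ ≠ 0`, an isomorphism preserves the line of degenerate characters. -/
lemma line_eq_zero (hr : r₁ ≠ 1) (hs : s₁ ≠ 1) (θ : A r₁ s₁ φ₁ ≃ₐ[K] A r₂ s₂ φ₂) (hφ : φ₂ ≠ 0) :
    line _ _ _ (θ (gu _ _ _)) = 0 ∧ line _ _ _ (θ (gd _ _ _)) = 0 := by
  set χ := (line _ _ _).comp (θ : A r₁ s₁ φ₁ →ₐ[K] A r₂ s₂ φ₂) with hχ
  have hc : (1 - r₁) * (1 - s₁) ≠ 0 :=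
    mul_ne_zero (sub_ne_zero.2 hr.symm) (sub_ne_zero.2 hs.symm)
  -- any two deformations of `χ` are proportional
  have key : ∀ (u d t u' d' t' : DualNumber K[X]),
      IsTriple (r₁ + s₁) (-(r₁ * s₁)) φ₁ u d t → IsTriple (r₁ + s₁) (-(r₁ * s₁)) φ₁ u' d' t' →
      u.fst = χ (gu _ _ _) → d.fst = χ (gd _ _ _) → t.fst = χ (gt _ _ _) →
      u'.fst = χ (gu _ _ _) → d'.fst = χ (gd _ _ _) → t'.fst = χ (gt _ _ _) →
      u.snd * d'.snd = d.snd * u'.snd ∧ u.snd * t'.snd = t.snd * u'.snd ∧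
        d.snd * t'.snd = t.snd * d'.snd := by
    intro u d t u' d' t' h h' hu hd ht hu' hd' ht'
    have e : ∀ {u d t : DualNumber K[X]} (h : IsTriple (r₁ + s₁) (-(r₁ * s₁)) φ₁ u d t),
        u.fst = χ (gu _ _ _) → d.fst = χ (gd _ _ _) → t.fst = χ (gt _ _ _) →
        ∃ ρ : K[X], u.snd = ρ * derivative (χ (gu _ _ _)) ∧
          d.snd = ρ * derivative (χ (gd _ _ _)) ∧ t.snd = ρ * derivative (χ (gt _ _ _)) := by
      intro u d t h hu hd ht
      have hf : (fstHom K K[X] K[X]).comp (lift h) = χ := hom_ext (by simpa) (by simpa) (by simpa)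
      obtain ⟨ρ, hρ⟩ := exists_snd_eq_mul_derivative θ hφ (lift h) (fun a => DFunLike.congr_fun hf a)
      refine ⟨ρ, ?_, ?_, ?_⟩
      · simpa [hχ] using hρ (gu _ _ _)
      · simpa [hχ] using hρ (gd _ _ _)
      · simpa [hχ] using hρ (gt _ _ _)
    obtain ⟨ρ, h1, h2, h3⟩ := e h hu hd ht
    obtain ⟨ρ', h1', h2', h3'⟩ := e h' hu' hd' ht'
    rw [h1, h2, h3, h1', h2', h3']
    refine ⟨by ring, by ring, by ring⟩
  obtain ⟨hu, hd⟩ := isTriple_comm_iff.1 ((isTriple_gen (r₁ + s₁) (-(r₁ * s₁)) φ₁).map χ)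
  change χ (gu _ _ _) = 0 ∧ χ (gd _ _ _) = 0
  set P := χ (gu _ _ _)
  set Q := χ (gd _ _ _)
  set R := χ (gt _ _ _)
  set c := (1 - r₁) * (1 - s₁)
  by_contra hne
  have hN : c • (P * Q) - aeval R φ₁ = 0 := by
    by_contra hN
    exact hne ⟨(mul_eq_zero.1 hu).resolve_right hN, (mul_eq_zero.1 hd).resolve_right hN⟩
  -- the tangent vectors `(P, -Q, 0)`, `(φ₁'(R), 0, c Q)`, `(0, φ₁'(R), c P)`
  set φ' := aeval R (derivative φ₁)
  have t1 : IsTriple (r₁ + s₁) (-(r₁ * s₁)) φ₁ (inl P + inr P : DualNumber K[X])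
      (inl Q + inr (-Q)) (inl R + inr 0) := by
    rw [isTriple_dual_iff]
    simp [c, hN]
  have t2 : IsTriple (r₁ + s₁) (-(r₁ * s₁)) φ₁ (inl P + inr φ' : DualNumber K[X])
      (inl Q + inr 0) (inl R + inr (c • Q)) := by
    rw [isTriple_dual_iff]
    simp [c, hN, φ', mul_comm Q (aeval R (derivative φ₁))]
  have t3 : IsTriple (r₁ + s₁) (-(r₁ * s₁)) φ₁ (inl P + inr 0 : DualNumber K[X])
      (inl Q + inr φ') (inl R + inr (c • P)) := by
    rw [isTriple_dual_iff]
    simp [c, hN, φ']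
  have k12 := (key _ _ _ _ _ _ t1 t2 (by simp) (by simp) (by simp) (by simp) (by simp)
    (by simp)).2.2
  have k13 := (key _ _ _ _ _ _ t1 t3 (by simp) (by simp) (by simp) (by simp) (by simp)
    (by simp)).2.1
  simp [hc, c] at k12 k13
  exact hne ⟨k13, k12⟩

/-- An isomorphism acts on the line of degenerate characters by an affine change of the coordinate.
The deformation `u ↦ ε` of this line, which exists modulo `φ₂`, pulls back to a deformation
transversal to the line of the source, and this forces `φ₁` to vanish modulo `φ₂`. -/
lemma exists_dvd_comp (hr : r₁ ≠ 1) (hs : s₁ ≠ 1) (θ : A r₁ s₁ φ₁ ≃ₐ[K] A r₂ s₂ φ₂)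
    (hφ : φ₂ ≠ 0) : φ₁ ≠ 0 ∧ ∃ a b : K, a ≠ 0 ∧ φ₂ ∣ φ₁.comp (C a * X + C b) := by
  obtain ⟨hu, hd⟩ := line_eq_zero hr hs θ hφ
  set χ := (line _ _ _).comp (θ : A r₁ s₁ φ₁ →ₐ[K] A r₂ s₂ φ₂) with hχ
  set R := χ (gt _ _ _) with hR
  have hfac : χ = (aeval R).comp (line _ _ _) := by
    apply hom_ext
    · simp [hχ, hu]
    · simp [hχ, hd]
    · simp [hR]
  have hfac' : ∀ a, line _ _ _ (θ a) = (line _ _ _ a).comp R := fun a =>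
    DFunLike.congr_fun hfac a
  have hdeg : R.natDegree = 1 := by
    have h := hfac' (θ.symm (gt _ _ _))
    have h' := congrArg natDegree h
    rw [natDegree_comp] at h'
    simp at h'
    exact Nat.eq_one_of_mul_eq_one_left h'.symm
  refine ⟨?_, R.coeff 1, R.coeff 0, ?_, ?_⟩
  · rintro rfl
    have t1 : IsTriple (r₁ + s₁) (-(r₁ * s₁)) 0 (inl 0 + inr 1 : DualNumber K[X])
        0 (inl R) := by
      rw [isTriple_dual_iff]
      simp
    have hf : (fstHom K K[X] K[X]).comp (DownUp.lift t1) = χ := by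
      apply hom_ext
      · simpa [hχ] using hu.symm
      · simpa [hχ] using hd.symm
      · simp [hR]
    obtain ⟨ρ, hρ⟩ := exists_snd_eq_mul_derivative θ hφ (DownUp.lift t1)
      (fun a => DFunLike.congr_fun hf a)
    have := hρ (gu _ _ _)
    rw [hu] at this
    simp at this
  · rw [← hdeg]
    exact leadingCoeff_ne_zero.2 (by rintro h; simp [h] at hdeg)
  · rw [← eq_X_add_C_of_natDegree_le_one hdeg.le]
    let q := Ideal.Quotient.mkₐ K (Ideal.span {φ₂})
    have t2 : IsTriple (r₂ + s₂) (-(r₂ * s₂)) φ₂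
        (inr 1 : DualNumber (K[X] ⧸ Ideal.span {φ₂})) 0 (inl (q X)) := by
      rw [isTriple_dual_iff]
      have : aeval (q X) φ₂ = 0 := by
        rw [aeval_algHom_apply]
        simp [q]
      simp [this]
    have hψ : (fstHom K _ _).comp (DownUp.lift t2) = q.comp (line _ _ _) := by
      apply hom_ext <;> simp
    set f := (DownUp.lift t2).comp (θ : A r₁ s₁ φ₁ →ₐ[K] A r₂ s₂ φ₂) with hf
    have hfst : ∀ y, (f y).fst = q ((line _ _ _ y).comp R) := fun y => by
      rw [← hfac']
      exact DFunLike.congr_fun hψ (θ y)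
    have h := isTriple_dual_iff.1 ((isTriple_gen (r₁ + s₁) (-(r₁ * s₁)) φ₁).map f)
    have hm : aeval (q R) φ₁ = q (φ₁.comp R) := by
      rw [aeval_algHom_apply, comp_eq_aeval]
    simp [hfst, hm] at h
    -- up to multiples of `φ₁(R)`, the deformation `f` is constant in the directions `u` and `d`
    have hg : ∀ y, (f y).fst = (aeval (f (gt _ _ _)) (line _ _ _ y)).fst ∧
        q (φ₁.comp R) * (f y).snd =
          q (φ₁.comp R) * (aeval (f (gt _ _ _)) (line _ _ _ y)).snd := by
      intro y
      induction y using gen_induction with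
      | hu =>
        simp only [hfst, line_gu, map_zero, zero_comp, fst_zero, snd_zero, mul_zero, true_and]
        linear_combination -h.1
      | hd =>
        simp only [hfst, line_gd, map_zero, zero_comp, fst_zero, snd_zero, mul_zero, true_and]
        linear_combination -h.2
      | ht => simp
      | hC k => simp
      | hadd x y hx hy => simp [mul_add, hx, hy]
      | hmul x y hx hy =>
        obtain ⟨hx1, hx2⟩ := hx
        obtain ⟨hy1, hy2⟩ := hy
        simp only [map_mul, fst_mul, DualNumber.snd_mul, hx1, hy1, true_and]
        linear_combination (aeval (f (gt _ _ _)) (line _ _ _ x)).fst * hy2 +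
          (aeval (f (gt _ _ _)) (line _ _ _ y)).fst * hx2
    have h0 : line _ _ _ (θ.symm (gu _ _ _)) = 0 := by
      have := hfac' (θ.symm (gu _ _ _))
      rw [AlgEquiv.apply_symm_apply, line_gu, eq_comm, comp_eq_zero_iff] at this
      refine this.resolve_right fun ⟨_, h⟩ => ?_
      rw [h, natDegree_C] at hdeg
      exact zero_ne_one hdeg
    have := (hg (θ.symm (gu _ _ _))).2
    rw [h0] at this
    simp [hf] at this
    exact Ideal.mem_span_singleton.1 (Ideal.Quotient.eq_zero_iff_mem.1 this)

/-- The class of `φ` up to affine substitutions and scalars is an isomorphism invariant. -/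
theorem affEquiv_of_algEquiv (hr₁ : r₁ ≠ 1) (hs₁ : s₁ ≠ 1) (hr₂ : r₂ ≠ 1) (hs₂ : s₂ ≠ 1)
    (θ : A r₁ s₁ φ₁ ≃ₐ[K] A r₂ s₂ φ₂) : AffEquiv φ₁ φ₂ := by
  by_cases h2 : φ₂ = 0
  · by_cases h1 : φ₁ = 0
    · exact ⟨1, 0, 1, one_ne_zero, one_ne_zero, by simp [h1, h2]⟩
    · exact absurd h2 (exists_dvd_comp hr₂ hs₂ θ.symm h1).1
  · obtain ⟨h1, a, b, ha, hab⟩ := exists_dvd_comp hr₁ hs₁ θ h2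
    obtain ⟨-, a', b', ha', hab'⟩ := exists_dvd_comp hr₂ hs₂ θ.symm h1
    have hdeg : ∀ {a b : K} (_ : a ≠ 0) (p : K[X]),
        (p.comp (C a * X + C b)).natDegree = p.natDegree := fun ha p => by
      rw [natDegree_comp, natDegree_linear ha, mul_one]
    have hne : ∀ {a b : K} (_ : a ≠ 0) {p : K[X]}, p ≠ 0 → p.comp (C a * X + C b) ≠ 0 := by
      intro a b ha p hp h
      rw [comp_eq_zero_iff] at h
      rcases h with h | ⟨-, h⟩
      · exact hp h
      · have := congrArg natDegree h
        rw [natDegree_linear ha] at this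
        simp at this
    obtain ⟨g, hg⟩ := hab
    have hg0 : g ≠ 0 := by rintro rfl; exact hne ha h1 (by simpa using hg)
    have hle := natDegree_le_of_dvd hab' (hne ha' h2)
    rw [hdeg ha'] at hle
    have hsum := congrArg natDegree hg
    rw [hdeg ha, natDegree_mul h2 hg0] at hsum
    have hgC : g = C (g.coeff 0) := eq_C_of_natDegree_eq_zero (by omega)
    refine ⟨a, b, g.coeff 0, ha, fun h => hg0 (by rw [hgC, h, C_0]), ?_⟩
    rw [hg, ← hgC, mul_comm]

end Line

/-! ### Two-dimensional triangular representations and the parameters -/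

section Param

variable {K : Type*} [Field K]

/-- The automorphism `v ↦ l v` of the Laurent polynomial ring `K[v, v⁻¹]`, for `l ≠ 0`. -/
noncomputable def scale {l : K} (hl : l ≠ 0) : LaurentPolynomial K →ₐ[K] LaurentPolynomial K :=
  AddMonoidAlgebra.lift K _ ℤ
    { toFun := fun n => (l ^ n.toAdd) • LaurentPolynomial.T n.toAdd
      map_one' := by simp
      map_mul' := fun m n => by
        rw [toAdd_mul, zpow_add₀ hl, LaurentPolynomial.T_add, smul_mul_smul_comm] }

lemma coeff_scale {l : K} (hl : l ≠ 0) (f : LaurentPolynomial K) (n : ℤ) :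
    (scale hl f).coeff n = l ^ n * f.coeff n := by
  induction f using LaurentPolynomial.induction_on' with
  | add p q hp hq => simp [hp, hq, mul_add]
  | C_mul_T m a =>
    rw [← LaurentPolynomial.single_eq_C_mul_T, scale, AddMonoidAlgebra.lift_single]
    by_cases h : m = n
    · subst h
      simp [LaurentPolynomial.T, mul_comm, -LaurentPolynomial.single_eq_C_mul_T]
    · simp [LaurentPolynomial.T, h, -LaurentPolynomial.single_eq_C_mul_T]

/-- A pair with `d u = l u d + m`, where `l` is a root of `x² - α x - β`, satisfies the relations
of the fibre of the down-up algebra at `t = 0`. -/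
lemma isTriple_of_mul_eq {B : Type*} [Ring B] [Algebra K B] {α β l m : K} {φ : K[X]} {u d : B}
    (h : d * u = l • (u * d) + m • 1) (hl : l ^ 2 = α * l + β)
    (hm : (l + 1 - α) * m = φ.coeff 0) : IsTriple α β φ u d 0 := by
  have hβ : β = l ^ 2 - α * l := by rw [hl]; ring
  have hd : d ^ 2 * u = (l ^ 2) • (u * d ^ 2) + ((l + 1) * m) • d := by
    rw [pow_two, mul_assoc, h, mul_add, mul_smul_comm, ← mul_assoc, h]
    simp only [add_mul, smul_mul_assoc, mul_smul_comm, mul_one, one_mul, mul_assoc, smul_add]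
    module
  have hu : d * u ^ 2 = (l ^ 2) • (u ^ 2 * d) + ((l + 1) * m) • u := by
    rw [pow_two, ← mul_assoc, h, add_mul, smul_mul_assoc, mul_assoc, h]
    simp only [mul_add, smul_mul_assoc, mul_smul_comm, mul_one, one_mul, mul_assoc, smul_add]
    module
  have e : aeval (0 : B) φ = φ.coeff 0 • 1 := by
    rw [← coeff_zero_eq_aeval_zero', Algebra.algebraMap_eq_smul_one]
  refine ⟨by simp, by simp, ?_, ?_⟩
  · rw [hd, h, e, ← hm, hβ, pow_two d]
    simp only [add_mul, smul_mul_assoc, mul_assoc, one_mul]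
    module
  · rw [hu, mul_assoc u d u, h, e, ← hm, hβ, pow_two u]
    simp only [mul_add, mul_smul_comm, mul_assoc, mul_one]
    module

/-- Where `φ(t)` is a scalar `p`, the element `d u - r u d + p / (s - 1)` commutes with `u` and `d`
up to the factor `s`. -/
lemma skew_normal {B : Type*} [Ring B] [Algebra K B] {r s p k : K} {φ : K[X]} {u d t : B}
    (h : IsTriple (r + s) (-(r * s)) φ u d t) (hp : aeval t φ = p • 1) (hk : (s - 1) * k = p) :
    d * (d * u - r • (u * d) + k • 1) = s • ((d * u - r • (u * d) + k • 1) * d) ∧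
    (d * u - r • (u * d) + k • 1) * u = s • (u * (d * u - r • (u * d) + k • 1)) := by
  have h1 := h.ddu
  have h2 := h.duu
  rw [hp, ← hk, pow_two] at h1 h2
  simp only [mul_assoc, smul_mul_assoc, one_mul, mul_smul_comm, mul_one] at h1 h2
  simp only [mul_add, add_mul, mul_sub, sub_mul, mul_assoc, smul_mul_assoc, one_mul,
    mul_smul_comm, mul_one, h1, h2]
  constructor <;> module

section Triangular

open Matrix

variable {L : Type*} [CommRing L] [IsDomain L] [Algebra K L]

/-- A strictly triangular matrix that commutes with `u` and `d` up to a factor records the ratio of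
their diagonal entries. -/
lemma diag_of_skew_commute {u d w : Matrix (Fin 2) (Fin 2) L} {μ : K}
    (h00 : w 0 0 = 0) (h10 : w 1 0 = 0) (h11 : w 1 1 = 0) (hw : w ≠ 0)
    (hdw : d * w = μ • (w * d)) (hwu : w * u = μ • (u * w)) :
    u 1 1 = μ • u 0 0 ∧ d 0 0 = μ • d 1 1 := by
  have h01 : w 0 1 ≠ 0 := by
    intro h
    apply hw
    ext i j
    fin_cases i <;> fin_cases j <;> simpa
  have e1 := congrFun (congrFun hdw 0) 1
  have e2 := congrFun (congrFun hwu 0) 1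
  simp [Matrix.mul_apply, Fin.sum_univ_two, h00, h11] at e1 e2
  constructor
  · apply mul_left_cancel₀ h01
    rw [e2, mul_smul_comm, mul_comm]
  · apply mul_right_cancel₀ h01
    rw [e1, smul_mul_assoc, mul_comm]

/-- In a non-commutative triangular representation in which `t` acts as a scalar, the two diagonal
characters differ by scaling with one of the parameters. -/
lemma exists_diag_ratio {r s τ : K} {φ : K[X]} {u d t : Matrix (Fin 2) (Fin 2) L}
    (hs : s ≠ 1) (h : IsTriple (r + s) (-(r * s)) φ u d t)
    (ht : t = algebraMap K _ τ) (hu : u 1 0 = 0) (hd : d 1 0 = 0)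
    (h0 : u 0 0 ≠ 0 ∨ d 0 0 ≠ 0) (h1 : u 1 1 ≠ 0 ∨ d 1 1 ≠ 0) (hud : d * u ≠ u * d) :
    ∃ μ : K, (μ = r ∨ μ = s) ∧ u 1 1 = μ • u 0 0 ∧ d 0 0 = μ • d 1 1 := by
  have hs' : s - 1 ≠ 0 := sub_ne_zero.2 hs
  have hp : aeval t φ = (φ.eval τ) • 1 := by
    rw [ht, aeval_algebraMap_apply, coe_aeval_eq_eval, Algebra.algebraMap_eq_smul_one]
  obtain ⟨k, hk⟩ : ∃ k, (s - 1) * k = φ.eval τ := ⟨(s - 1)⁻¹ * φ.eval τ, by field_simp⟩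
  obtain ⟨hdw, hwu⟩ := skew_normal h hp hk
  set w := d * u - r • (u * d) + k • 1 with hw
  have w10 : w 1 0 = 0 := by
    simp [hw, Matrix.mul_apply, Fin.sum_univ_two, hu, hd]
  -- on the diagonal, commuting up to the factor `s ≠ 1` means annihilating
  have key : ∀ x y z : L, x ≠ 0 ∨ y ≠ 0 → y * z = s • (z * y) → z * x = s • (x * z) → z = 0 := by
    intro x y z hxy e1 e2
    have e1' : (1 - s) • (y * z) = 0 := by
      rw [sub_smul, one_smul, sub_eq_zero, mul_comm y z, ← e1, mul_comm]
    have e2' : (1 - s) • (x * z) = 0 := by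
      rw [sub_smul, one_smul, sub_eq_zero, ← e2, mul_comm]
    have hs'' : 1 - s ≠ 0 := sub_ne_zero.2 hs.symm
    rw [smul_eq_zero_iff_right hs''] at e1' e2'
    rcases hxy with hx | hy
    · exact (mul_eq_zero.1 e2').resolve_left hx
    · exact (mul_eq_zero.1 e1').resolve_left hy
  have w00 : w 0 0 = 0 := by
    apply key _ _ _ h0
    · simpa [Matrix.mul_apply, Fin.sum_univ_two, hu, hd, w10] using congrFun (congrFun hdw 0) 0
    · simpa [Matrix.mul_apply, Fin.sum_univ_two, hu, hd, w10] using congrFun (congrFun hwu 0) 0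
  have w11 : w 1 1 = 0 := by
    apply key _ _ _ h1
    · simpa [Matrix.mul_apply, Fin.sum_univ_two, hu, hd, w10] using congrFun (congrFun hdw 1) 1
    · simpa [Matrix.mul_apply, Fin.sum_univ_two, hu, hd, w10] using congrFun (congrFun hwu 1) 1
  by_cases hw0 : w = 0
  · -- now `d u = r u d - k`, and the commutator commutes with `u` and `d` up to the factor `r`
    have e : d * u = r • (u * d) - k • 1 := by
      rw [← sub_eq_zero, ← hw0, hw]
      abel
    refine ⟨r, Or.inl rfl, diag_of_skew_commute (w := d * u - u * d) ?_ ?_ ?_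
      (sub_ne_zero.2 hud) ?_ ?_⟩
    · simp [Matrix.mul_apply, Fin.sum_univ_two, hu, hd, mul_comm]
    · simp [Matrix.mul_apply, Fin.sum_univ_two, hu, hd, mul_comm]
    · simp [Matrix.mul_apply, Fin.sum_univ_two, hu, hd, mul_comm]
    · rw [e]
      simp only [mul_sub, sub_mul, mul_smul_comm, smul_mul_assoc, ← mul_assoc, e, mul_one, one_mul]
      module
    · rw [e]
      simp only [mul_sub, sub_mul, mul_smul_comm, smul_mul_assoc, mul_assoc, e, mul_one, one_mul]
      module
  · exact ⟨s, Or.inr rfl, diag_of_skew_commute w00 w10 w11 hw0 hdw hwu⟩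

end Triangular

lemma commute_of_commute_gen {B : Type*} [Ring B] [Algebra K B] {α β : K} {φ : K[X]}
    {f : Alg α β φ →ₐ[K] B} (h : Commute (f (gu _ _ _)) (f (gd _ _ _))) (x y : Alg α β φ) :
    Commute (f x) (f y) := by
  have key : ∀ b : B, Commute (f (gu _ _ _)) b → Commute (f (gd _ _ _)) b →
      Commute (f (gt _ _ _)) b → ∀ x, Commute (f x) b := by
    intro b hu hd ht x
    induction x using gen_induction with
    | hu => exact hu
    | hd => exact hd
    | ht => exact ht
    | hC k => simpa using Algebra.commute_algebraMap_left k b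
    | hadd x y hx hy => simpa using hx.add_left hy
    | hmul x y hx hy => simpa using hx.mul_left hy
  have ht : ∀ x, Commute (f (gt _ _ _)) (f x) := fun x => (commute_gt x).map f
  refine key _ (key _ (Commute.refl _) h.symm (ht _) y).symm
    (key _ h (Commute.refl _) (ht _) y).symm (ht y) x

end Param

section Rep

variable {K : Type*} [Field K]

open Matrix

/-- The constant `k` for which `u ↦ v`, `d ↦ k v⁻¹`, `t ↦ 0` is a character of `A r s φ`. -/
noncomputable def fibreConst (r s : K) (φ : K[X]) : K := ((1 - r) * (1 - s))⁻¹ * φ.coeff 0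

lemma isTriple_torus {r s : K} (hr : r ≠ 1) (hs : s ≠ 1) (φ : K[X]) :
    IsTriple (r + s) (-(r * s)) φ (LaurentPolynomial.T 1 : LaurentPolynomial K)
      (fibreConst r s φ • LaurentPolynomial.T (-1)) 0 := by
  have hc : (1 - r) * (1 - s) ≠ 0 :=
    mul_ne_zero (sub_ne_zero.2 hr.symm) (sub_ne_zero.2 hs.symm)
  have h : ((1 - r) * (1 - s)) • ((LaurentPolynomial.T 1 : LaurentPolynomial K) *
      (fibreConst r s φ • LaurentPolynomial.T (-1))) - aeval 0 φ = 0 := by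
    rw [mul_smul_comm, ← LaurentPolynomial.T_add, ← coeff_zero_eq_aeval_zero', smul_smul,
      fibreConst, mul_inv_cancel_left₀ hc, Algebra.algebraMap_eq_smul_one]
    simp
  rw [isTriple_comm_iff, h, mul_zero, mul_zero]
  exact ⟨rfl, rfl⟩

/-- The generic character of the fibre of `A r s φ` at `t = 0` with `u` invertible, with values in
the Laurent polynomials in `v`. -/
noncomputable def torus {r s : K} (hr : r ≠ 1) (hs : s ≠ 1) (φ : K[X]) :
    A r s φ →ₐ[K] LaurentPolynomial K :=
  DownUp.lift (isTriple_torus hr hs φ)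

lemma isTriple_triangular {r s l : K} (hr : r ≠ 1) (hs : s ≠ 1) (hl : l = r ∨ l = s) (hl0 : l ≠ 0)
    (φ : K[X]) :
    IsTriple (r + s) (-(r * s)) φ
      !![(LaurentPolynomial.T 1 : LaurentPolynomial K), 0; 0, l • LaurentPolynomial.T 1]
      !![fibreConst r s φ • LaurentPolynomial.T (-1), 1;
        0, (l⁻¹ * fibreConst r s φ) • LaurentPolynomial.T (-1)] 0 := by
  have hr' : 1 - r ≠ 0 := sub_ne_zero.2 hr.symm
  have hs' : 1 - s ≠ 0 := sub_ne_zero.2 hs.symm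
  refine isTriple_of_mul_eq (l := l) (m := (1 - l) * fibreConst r s φ) ?_ ?_ ?_
  · have hT : (LaurentPolynomial.T 1 : LaurentPolynomial K) * LaurentPolynomial.T (-1) = 1 := by
      rw [← LaurentPolynomial.T_add]; simp
    ext1 i j
    fin_cases i <;> fin_cases j <;>
      simp [Matrix.mul_apply, Fin.sum_univ_two, -LaurentPolynomial.T_mul]
    · rw [mul_comm, hT]
      module
    · rw [mul_comm (LaurentPolynomial.T (-1)), hT]
      simp only [smul_smul, ← add_smul]
      congr 1
      field_simp
      ring
  · rcases hl with rfl | rfl <;> ring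
  · rw [fibreConst]
    rcases hl with rfl | rfl <;> field_simp <;> ring

/-- An extension of the generic character `torus` by its translate under `v ↦ l v`, for
`l ∈ {r, s}`, as a representation by triangular matrices. -/
noncomputable def triangular {r s l : K} (hr : r ≠ 1) (hs : s ≠ 1) (hl : l = r ∨ l = s)
    (hl0 : l ≠ 0) (φ : K[X]) : A r s φ →ₐ[K] Matrix (Fin 2) (Fin 2) (LaurentPolynomial K) :=
  DownUp.lift (isTriple_triangular hr hs hl hl0 φ)

lemma scale_T {l : K} (hl : l ≠ 0) (n : ℤ) :
    scale hl (LaurentPolynomial.T n) = l ^ n • LaurentPolynomial.T n := by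
  rw [scale, LaurentPolynomial.T, AddMonoidAlgebra.lift_single, one_smul]
  rfl

lemma triangular_apply {r s l : K} (hr : r ≠ 1) (hs : s ≠ 1) (hl : l = r ∨ l = s) (hl0 : l ≠ 0)
    (φ : K[X]) (x : A r s φ) : triangular hr hs hl hl0 φ x 1 0 = 0 ∧
      triangular hr hs hl hl0 φ x 0 0 = torus hr hs φ x ∧
      triangular hr hs hl hl0 φ x 1 1 = scale hl0 (torus hr hs φ x) := by
  induction x using gen_induction with
  | hu => simp [triangular, torus, scale_T]
  | hd => simp [triangular, torus, scale_T, smul_smul, mul_comm]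
  | ht => simp [triangular, torus]
  | hC k =>
    rw [AlgHom.commutes, AlgHom.commutes, AlgHom.commutes]
    simp [Matrix.algebraMap_matrix_apply]
  | hadd x y hx hy => simp [hx, hy]
  | hmul x y hx hy => simp [Matrix.mul_apply, Fin.sum_univ_two, hx, hy]

variable {r₁ s₁ r₂ s₂ : K} {φ₁ φ₂ : K[X]}

lemma zpow_injective {l : K} (hl0 : l ≠ 0) (hl : ¬ IsOfFinOrder l) {m n : ℤ}
    (h : l ^ m = l ^ n) : m = n := by
  have : ¬ IsOfFinOrder (Units.mk0 l hl0) := fun h => hl (by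
    simpa using (Units.coeHom K).isOfFinOrder h)
  refine injective_zpow_iff_not_isOfFinOrder.2 this ?_
  ext
  simpa using h

/-- The image of the central element `t` is a scalar: it commutes with `triangular`, hence is
invariant under `v ↦ l v`, and `l` is not a root of unity. -/
lemma triangular_gt_eq_algebraMap (hr : r₂ ≠ 1) (hs : s₂ ≠ 1) {l : K} (hl : l = r₂ ∨ l = s₂)
    (hl0 : l ≠ 0) (hlf : ¬ IsOfFinOrder l) (θ : A r₁ s₁ φ₁ ≃ₐ[K] A r₂ s₂ φ₂) :
    ∃ τ : K, triangular hr hs hl hl0 φ₂ (θ (gt _ _ _)) = algebraMap K _ τ := by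
  have hc : ∀ x, Commute (triangular hr hs hl hl0 φ₂ (θ (gt _ _ _)))
      (triangular hr hs hl hl0 φ₂ x) := fun x => by
    simpa using (commute_gt (θ.symm x)).map ((triangular hr hs hl hl0 φ₂).comp
      (θ : A r₁ s₁ φ₁ →ₐ[K] A r₂ s₂ φ₂))
  have hu := congrFun (congrFun (hc (gu _ _ _)).eq 0) 1
  have hd := congrFun (congrFun (hc (gd _ _ _)).eq 0) 1
  obtain ⟨h10, h00, h11⟩ := triangular_apply hr hs hl hl0 φ₂ (θ (gt _ _ _))
  set M := triangular hr hs hl hl0 φ₂ (θ (gt _ _ _))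
  set f := torus hr hs φ₂ (θ (gt _ _ _))
  have hl1 : l - 1 ≠ 0 := sub_ne_zero.2 (by rcases hl with rfl | rfl <;> assumption)
  simp [triangular, Matrix.mul_apply, Fin.sum_univ_two] at hu hd
  have h01 : M 0 1 = 0 := by
    have h : (l - 1) • (M 0 1 * LaurentPolynomial.T 1) = 0 := by
      rw [sub_smul, one_smul, hu, sub_self]
    exact (mul_eq_zero.1 ((smul_eq_zero_iff_right hl1).1 h)).resolve_right
      (LaurentPolynomial.isUnit_T 1).ne_zero
  replace hd : f = scale hl0 f := by simpa [h01, h00, h11] using hd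
  have hf : f = algebraMap K _ (f.coeff 0) := by
    ext n
    by_cases hn : n = 0
    · simp [hn]
    · have := congrArg (fun g : LaurentPolynomial K => g.coeff n) hd
      simp only [coeff_scale] at this
      have h0 : f.coeff n = 0 := by
        by_contra hne
        refine hn (zpow_injective hl0 hlf ?_)
        rw [zpow_zero]
        exact (mul_right_cancel₀ hne (by rw [one_mul]; exact this)).symm
      simp [h0, hn]
  refine ⟨f.coeff 0, ?_⟩
  ext1 i j
  rw [Matrix.algebraMap_matrix_apply]
  fin_cases i <;> fin_cases j
  · simpa [h00] using hf
  · simpa using h01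
  · simpa using h10
  · simpa [h11] using hd.symm.trans hf

/-- The pullback of `triangular` along an isomorphism constrains the degrees in `v` of the images
of `u` and `d`. -/
lemma exists_ratio (hs₁ : s₁ ≠ 1) (hr : r₂ ≠ 1) (hs : s₂ ≠ 1) {l : K} (hl : l = r₂ ∨ l = s₂)
    (hl0 : l ≠ 0) (hlf : ¬ IsOfFinOrder l) (θ : A r₁ s₁ φ₁ ≃ₐ[K] A r₂ s₂ φ₂)
    (h0 : torus hr hs φ₂ (θ (gu _ _ _)) ≠ 0 ∨ torus hr hs φ₂ (θ (gd _ _ _)) ≠ 0) :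
    ∃ μ : K, (μ = r₁ ∨ μ = s₁) ∧
      (∀ n, (torus hr hs φ₂ (θ (gu _ _ _))).coeff n ≠ 0 → l ^ n = μ) ∧
      (∀ n, (torus hr hs φ₂ (θ (gd _ _ _))).coeff n ≠ 0 → μ * l ^ n = 1) := by
  obtain ⟨τ, hτ⟩ := triangular_gt_eq_algebraMap hr hs hl hl0 hlf θ
  set F := (triangular hr hs hl hl0 φ₂).comp (θ : A r₁ s₁ φ₁ →ₐ[K] A r₂ s₂ φ₂) with hF
  have hFa : ∀ x, F x 1 0 = 0 ∧ F x 0 0 = torus hr hs φ₂ (θ x) ∧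
      F x 1 1 = scale hl0 (torus hr hs φ₂ (θ x)) := fun x => triangular_apply hr hs hl hl0 φ₂ (θ x)
  have hinj : ∀ f : LaurentPolynomial K, f ≠ 0 → scale hl0 f ≠ 0 := by
    intro f hf h
    apply hf
    ext n
    simpa [coeff_scale, hl0, zpow_ne_zero] using
      congrArg (fun g : LaurentPolynomial K => g.coeff n) h
  have hne : F (gd _ _ _) * F (gu _ _ _) ≠ F (gu _ _ _) * F (gd _ _ _) := by
    intro h
    have hcomm := commute_of_commute_gen (f := F) h.symm (θ.symm (gu _ _ _)) (θ.symm (gd _ _ _))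
    have := congrFun (congrFun hcomm.eq 0) 1
    simp [hF, triangular, Matrix.mul_apply, Fin.sum_univ_two] at this
    have h' : (l - 1) • (LaurentPolynomial.T 1 : LaurentPolynomial K) = 0 := by
      rw [sub_smul, one_smul, ← this, sub_self]
    have hl1 : l - 1 ≠ 0 := sub_ne_zero.2 (by rcases hl with rfl | rfl <;> assumption)
    exact (LaurentPolynomial.isUnit_T 1).ne_zero ((smul_eq_zero_iff_right hl1).1 h')
  obtain ⟨μ, hμ, hu, hd⟩ := exists_diag_ratio hs₁
    ((isTriple_gen (r₁ + s₁) (-(r₁ * s₁)) φ₁).map F) hτ (hFa _).1 (hFa _).1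
    (by rwa [(hFa _).2.1, (hFa _).2.1])
    (by rw [(hFa _).2.2, (hFa _).2.2]; exact h0.imp (hinj _) (hinj _)) hne
  rw [(hFa _).2.1, (hFa _).2.2] at hu hd
  refine ⟨μ, hμ, fun n hn => ?_, fun n hn => ?_⟩
  · have := congrArg (fun g : LaurentPolynomial K => g.coeff n) hu
    simpa [coeff_scale, hn] using this
  · have := congrArg (fun g : LaurentPolynomial K => g.coeff n) hd
    apply mul_right_cancel₀ hn
    rw [one_mul, mul_assoc, ← coeff_scale hl0]
    simpa using this.symm

/-- The images of the generators generate an algebra containing `v`, so their exponents have no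
common divisor. -/
lemma dvd_one_of_coeff (hr : r₂ ≠ 1) (hs : s₂ ≠ 1) (hr0 : r₂ ≠ 0) (hrf : ¬ IsOfFinOrder r₂)
    (θ : A r₁ s₁ φ₁ ≃ₐ[K] A r₂ s₂ φ₂) {n : ℤ}
    (hu : ∀ m, (torus hr hs φ₂ (θ (gu _ _ _))).coeff m ≠ 0 → n ∣ m)
    (hd : ∀ m, (torus hr hs φ₂ (θ (gd _ _ _))).coeff m ≠ 0 → n ∣ m) : n ∣ 1 := by
  have hC : ∀ (k : K) (m : ℤ), (algebraMap K (LaurentPolynomial K) k).coeff m ≠ 0 → n ∣ m := by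
    intro k m hm
    have : m = 0 := by
      by_contra h
      simp [h] at hm
    simp [this]
  obtain ⟨τ, hτ⟩ := triangular_gt_eq_algebraMap hr hs (Or.inl rfl) hr0 hrf θ
  have ht : torus hr hs φ₂ (θ (gt _ _ _)) = algebraMap K _ τ := by
    rw [← (triangular_apply hr hs (Or.inl rfl) hr0 φ₂ _).2.1, hτ]
    simp [Matrix.algebraMap_matrix_apply]
  have key : ∀ x, ∀ m, (torus hr hs φ₂ (θ x)).coeff m ≠ 0 → n ∣ m := by
    intro x
    induction x using gen_induction with
    | hu => exact hu
    | hd => exact hd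
    | ht => rw [ht]; exact hC τ
    | hC k => rw [AlgEquiv.commutes, AlgHom.commutes]; exact hC k
    | hadd x y hx hy =>
      intro m hm
      rw [map_add, map_add, AddMonoidAlgebra.coeff_add, Finsupp.add_apply] at hm
      by_cases h : (torus hr hs φ₂ (θ x)).coeff m = 0
      · rw [h, zero_add] at hm
        exact hy m hm
      · exact hx m h
    | hmul x y hx hy =>
      intro m hm
      rw [map_mul, map_mul] at hm
      classical
      obtain ⟨a, ha, b, hb, rfl⟩ := Finset.mem_add.1
        (AddMonoidAlgebra.support_coeff_mul_subset _ _ (Finsupp.mem_support_iff.2 hm))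
      exact dvd_add (hx a (Finsupp.mem_support_iff.1 ha)) (hy b (Finsupp.mem_support_iff.1 hb))
  refine key (θ.symm (gu _ _ _)) 1 ?_
  simp [torus]

/-- The parameters of two isomorphic down-up algebras agree up to simultaneous inversion. The
exponent is the degree of the map induced on the generic torus of characters. -/
theorem exists_zpow_eq (hs₁ : s₁ ≠ 1) (hr0 : r₂ ≠ 0) (hs0 : s₂ ≠ 0) (hrf : ¬ IsOfFinOrder r₂)
    (hsf : ¬ IsOfFinOrder s₂) (θ : A r₁ s₁ φ₁ ≃ₐ[K] A r₂ s₂ φ₂) :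
    ∃ n : ℤ, (n = 1 ∨ n = -1) ∧ (r₂ ^ n = r₁ ∨ r₂ ^ n = s₁) ∧ (s₂ ^ n = r₁ ∨ s₂ ^ n = s₁) := by
  have hr : r₂ ≠ 1 := by rintro rfl; exact hrf IsOfFinOrder.one
  have hs : s₂ ≠ 1 := by rintro rfl; exact hsf IsOfFinOrder.one
  have h0 : torus hr hs φ₂ (θ (gu _ _ _)) ≠ 0 ∨ torus hr hs φ₂ (θ (gd _ _ _)) ≠ 0 := by
    by_contra! h
    have := dvd_one_of_coeff (n := 0) hr hs hr0 hrf θ (by simp [h.1]) (by simp [h.2])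
    simp at this
  -- an exponent `n` such that `u` maps to a multiple of `v ^ n`, or `d` to a multiple of `v ^ (-n)`
  obtain ⟨n, hn⟩ : ∃ n : ℤ, (torus hr hs φ₂ (θ (gu _ _ _))).coeff n ≠ 0 ∨
      (torus hr hs φ₂ (θ (gd _ _ _))).coeff (-n) ≠ 0 := by
    by_contra! h
    rcases h0 with h0 | h0
    · exact h0 (LaurentPolynomial.ext fun n => by simpa using (h n).1)
    · exact h0 (LaurentPolynomial.ext fun n => by simpa using (h (-n)).2)
  have hratio : ∀ l : K, l = r₂ ∨ l = s₂ → l ≠ 0 → ¬ IsOfFinOrder l → (l ^ n = r₁ ∨ l ^ n = s₁) ∧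
      (∀ m, (torus hr hs φ₂ (θ (gu _ _ _))).coeff m ≠ 0 → l ^ m = l ^ n) ∧
      (∀ m, (torus hr hs φ₂ (θ (gd _ _ _))).coeff m ≠ 0 → l ^ m = l ^ (-n)) := by
    intro l hl hl0 hlf
    obtain ⟨μ, hμ, hu, hd⟩ := exists_ratio hs₁ hr hs hl hl0 hlf θ h0
    have e : l ^ n = μ := by
      rcases hn with hn | hn
      · exact hu n hn
      · have := hd _ hn
        rw [_root_.zpow_neg] at this
        exact (eq_of_mul_inv_eq_one this).symm
    refine ⟨by rwa [e], fun m hm => by rw [e, hu m hm], fun m hm => ?_⟩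
    rw [_root_.zpow_neg, e]
    exact eq_inv_of_mul_eq_one_right (hd m hm)
  obtain ⟨h1, hu, hd⟩ := hratio r₂ (Or.inl rfl) hr0 hrf
  refine ⟨n, Int.isUnit_iff.1 (isUnit_of_dvd_one ?_), h1, (hratio s₂ (Or.inr rfl) hs0 hsf).1⟩
  refine dvd_one_of_coeff hr hs hr0 hrf θ (fun m hm => ?_) (fun m hm => ?_)
  · rw [zpow_injective hr0 hrf (hu m hm)]
  · rw [zpow_injective hr0 hrf (hd m hm), dvd_neg]

end Rep

/-! ### Classification -/

section Classification

variable {K : Type*} [Field K]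

lemma MulIndep.zpow_left {r s : K} (h : MulIndep r s) {n : ℤ} (hn : r ^ n = 1) : n = 0 :=
  (h n 0 (by simpa using hn)).1

lemma MulIndep.zpow_right {r s : K} (h : MulIndep r s) {n : ℤ} (hn : s ^ n = 1) : n = 0 :=
  (h 0 n (by simpa using hn)).2

lemma MulIndep.not_isOfFinOrder {r s : K} (h : MulIndep r s) :
    ¬ IsOfFinOrder r ∧ ¬ IsOfFinOrder s := by
  constructor <;> intro hf <;> obtain ⟨n, hn, h1⟩ := isOfFinOrder_iff_pow_eq_one.1 hf
  · have := h.zpow_left (n := n) (by simpa using h1)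
    omega
  · have := h.zpow_right (n := n) (by simpa using h1)
    omega

lemma ne_one_of_not_isOfFinOrder {r : K} (h : ¬ IsOfFinOrder r) : r ≠ 1 := by
  rintro rfl
  exact h IsOfFinOrder.one

lemma exists_zpow_eq_of_mulIndep {r₁ s₁ r₂ s₂ : K} {φ₁ φ₂ : K[X]} (hr0 : r₁ ≠ 0) (hs0 : s₁ ≠ 0)
    (h : MulIndep r₁ s₁) (hs : s₂ ≠ 1) (θ : A r₁ s₁ φ₁ ≃ₐ[K] A r₂ s₂ φ₂) :
    ∃ n : ℤ, (n = 1 ∨ n = -1) ∧ ((r₂ = r₁ ^ n ∧ s₂ = s₁ ^ n) ∨ (r₂ = s₁ ^ n ∧ s₂ = r₁ ^ n)) := by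
  obtain ⟨hr, hs⟩ := h.not_isOfFinOrder
  obtain ⟨n, hn, h1, h2⟩ := exists_zpow_eq ‹s₂ ≠ 1› hr0 hs0 hr hs θ.symm
  refine ⟨n, hn, ?_⟩
  -- independence makes `r₁ ^ n` and `s₁ ^ n` distinct
  have hne : r₁ ^ n ≠ s₁ ^ n := by
    intro e
    have := (h n (-n) (by rw [zpow_neg, e, mul_inv_cancel₀ (zpow_ne_zero _ hs0)])).1
    omega
  rcases h1 with h1 | h1 <;> rcases h2 with h2 | h2
  · exact absurd (h1.trans h2.symm) hne
  · exact Or.inl ⟨h1.symm, h2.symm⟩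
  · exact Or.inr ⟨h2.symm, h1.symm⟩
  · exact absurd (h1.trans h2.symm) hne

lemma MulIndep.symm {r s : K} (h : MulIndep r s) : MulIndep s r := fun i j e =>
  (h j i (by rwa [mul_comm])).symm

lemma MulIndep.zpow {r s : K} (h : MulIndep r s) {n : ℤ} (hn : n ≠ 0) :
    MulIndep (r ^ n) (s ^ n) := fun i j e => by
  rw [← zpow_mul, ← zpow_mul] at e
  simpa [hn] using h _ _ e

lemma nonempty_algEquiv_inv_of_affEquiv {r s : K} (hr : r ≠ 0) (hs : s ≠ 0) {φ₁ φ₂ : K[X]}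
    (h : AffEquiv φ₁ φ₂) : Nonempty (A r s φ₁ ≃ₐ[K] A r⁻¹ s⁻¹ φ₂) := by
  obtain ⟨e₁⟩ := nonempty_algEquiv_inv hr hs φ₁
  have h' : AffEquiv (C (r⁻¹ * s⁻¹) * φ₁) φ₁ :=
    ⟨1, 0, r⁻¹ * s⁻¹, one_ne_zero, mul_ne_zero (inv_ne_zero hr) (inv_ne_zero hs), by simp⟩
  obtain ⟨e₂⟩ := nonempty_algEquiv_of_affEquiv (r⁻¹ + s⁻¹) (-(r⁻¹ * s⁻¹)) h'
  obtain ⟨e₃⟩ := nonempty_algEquiv_of_affEquiv (r⁻¹ + s⁻¹) (-(r⁻¹ * s⁻¹)) h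
  exact ⟨(e₁.trans e₂).trans e₃⟩

lemma nonempty_algEquiv_iff {r s : K} {φ₁ φ₂ : K[X]} (hr : r ≠ 1) (hs : s ≠ 1) :
    Nonempty (A r s φ₁ ≃ₐ[K] A r s φ₂) ↔ AffEquiv φ₁ φ₂ :=
  ⟨fun ⟨θ⟩ => affEquiv_of_algEquiv hr hs hr hs θ, nonempty_algEquiv_of_affEquiv _ _⟩

/-- The two parameters of a down-up algebra play symmetric roles. -/
lemma nonempty_algEquiv_comm (r s : K) (φ : K[X]) : Nonempty (A r s φ ≃ₐ[K] A s r φ) := by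
  change Nonempty (Alg (r + s) (-(r * s)) φ ≃ₐ[K] Alg (s + r) (-(s * r)) φ)
  rw [add_comm s r, mul_comm s r]
  exact ⟨AlgEquiv.refl⟩

end Classification

end DownUp

theorem theorem3p4 {K : Type*} [Field K] [CharZero K] :
    (∀ (r₁ s₁ r₂ s₂ : K) (φ₁ φ₂ : Polynomial K),
      r₁ ≠ 0 → s₁ ≠ 0 → r₂ ≠ 0 → s₂ ≠ 0 →
      ¬ IsOfFinOrder r₂ → ¬ IsOfFinOrder s₂ →
      DownUp.MulIndep r₁ s₁ → ¬ DownUp.MulIndep r₂ s₂ →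
      ¬ Nonempty (DownUp.A r₁ s₁ φ₁ ≃ₐ[K] DownUp.A r₂ s₂ φ₂)) ∧
    (∀ (r s : K) (φ₁ φ₂ : Polynomial K), r ≠ 0 → s ≠ 0 → DownUp.MulIndep r s →
      (Nonempty (DownUp.A r s φ₁ ≃ₐ[K] DownUp.A r s φ₂) ↔ DownUp.AffEquiv φ₁ φ₂)) ∧
    (∀ (r₁ s₁ r₂ s₂ : K) (φ₁ φ₂ : Polynomial K),
      r₁ ≠ 0 → s₁ ≠ 0 → r₂ ≠ 0 → s₂ ≠ 0 →
      DownUp.MulIndep r₁ s₁ → DownUp.MulIndep r₂ s₂ →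
      (Nonempty (DownUp.A r₁ s₁ φ₁ ≃ₐ[K] DownUp.A r₂ s₂ φ₂) ↔
        (r₁ = r₂ ∧ s₁ = s₂ ∧ DownUp.AffEquiv φ₁ φ₂) ∨
        (r₁ = s₂ ∧ r₂ = s₁ ∧ DownUp.AffEquiv φ₁ φ₂) ∨
        (r₁ = s₂⁻¹ ∧ r₂ = s₁⁻¹ ∧ DownUp.AffEquiv φ₁ φ₂) ∨
        (r₁ = r₂⁻¹ ∧ s₁ = s₂⁻¹ ∧ DownUp.AffEquiv φ₁ φ₂))) ∧
    (∀ (r : K) (φ₁ φ₂ : Polynomial K), r ≠ 0 → ¬ IsOfFinOrder r →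
      (Nonempty (DownUp.A r r⁻¹ φ₁ ≃ₐ[K] DownUp.A r r⁻¹ φ₂) ↔ DownUp.AffEquiv φ₁ φ₂)) := by
  refine ⟨?_, ?_, ?_, ?_⟩
  · rintro r₁ s₁ r₂ s₂ φ₁ φ₂ hr₁ hs₁ - - - hs₂ h₁ h₂ ⟨θ⟩
    obtain ⟨n, hn, h⟩ := DownUp.exists_zpow_eq_of_mulIndep hr₁ hs₁ h₁
      (DownUp.ne_one_of_not_isOfFinOrder hs₂) θ
    have hn0 : n ≠ 0 := by omega
    rcases h with ⟨rfl, rfl⟩ | ⟨rfl, rfl⟩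
    · exact h₂ (h₁.zpow hn0)
    · exact h₂ (h₁.symm.zpow hn0)
  · intro r s φ₁ φ₂ _ _ h
    exact DownUp.nonempty_algEquiv_iff
      (DownUp.ne_one_of_not_isOfFinOrder h.not_isOfFinOrder.1)
      (DownUp.ne_one_of_not_isOfFinOrder h.not_isOfFinOrder.2)
  · intro r₁ s₁ r₂ s₂ φ₁ φ₂ hr₁ hs₁ _ _ h₁ h₂
    constructor
    · rintro ⟨θ⟩
      have hs₂ := DownUp.ne_one_of_not_isOfFinOrder h₂.not_isOfFinOrder.2
      have hφ := DownUp.affEquiv_of_algEquiv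
        (DownUp.ne_one_of_not_isOfFinOrder h₁.not_isOfFinOrder.1)
        (DownUp.ne_one_of_not_isOfFinOrder h₁.not_isOfFinOrder.2)
        (DownUp.ne_one_of_not_isOfFinOrder h₂.not_isOfFinOrder.1) hs₂ θ
      obtain ⟨n, rfl | rfl, ⟨rfl, rfl⟩ | ⟨rfl, rfl⟩⟩ :=
        DownUp.exists_zpow_eq_of_mulIndep hr₁ hs₁ h₁ hs₂ θ
      all_goals simp [hφ]
    · rintro (⟨rfl, rfl, h⟩ | ⟨rfl, rfl, h⟩ | ⟨rfl, rfl, h⟩ | ⟨rfl, rfl, h⟩)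
      · exact DownUp.nonempty_algEquiv_of_affEquiv _ _ h
      · obtain ⟨e₁⟩ := DownUp.nonempty_algEquiv_of_affEquiv (r₁ + r₂) (-(r₁ * r₂)) h
        obtain ⟨e₂⟩ := DownUp.nonempty_algEquiv_comm r₁ r₂ φ₂
        exact ⟨e₁.trans e₂⟩
      · obtain ⟨e₁⟩ := DownUp.nonempty_algEquiv_comm s₂⁻¹ s₁ φ₁
        obtain ⟨e₂⟩ := DownUp.nonempty_algEquiv_inv_of_affEquiv hs₁ hr₁ h
        rw [inv_inv] at e₂
        exact ⟨e₁.trans e₂⟩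
      · have := DownUp.nonempty_algEquiv_inv_of_affEquiv hr₁ hs₁ h
        rwa [inv_inv, inv_inv] at this
  · intro r φ₁ φ₂ _ hr
    refine DownUp.nonempty_algEquiv_iff (DownUp.ne_one_of_not_isOfFinOrder hr) ?_
    rw [ne_eq, inv_eq_one]
    exact DownUp.ne_one_of_not_isOfFinOrder hr
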